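/- Let $A$ be a set (not necessarily finite) and let $G$ be an undirected graph on $A$, that is, a symmetric binary relation on $A$ (loops $v\to v$ are allowed). Let $a\in A$ be a vertex that lies on a cycle of odd length in $G$; here it suffices that $a$ occurs in a closed walk $v_0\to v_1\to\dots\to v_l=v_0$ of odd length $l$ in $G$, possibly with repeated vertices. Let $f\colon A^n\to A$ be an operation such that 1. $f$ is idempotent: $f(x,x,\dots,x)=x$ for every $x\in A$; 2. $f$ is compatible with $G$: whenever $u_i\to v_i$ is an edge of $G$ for every $i\in\{0,\dots,n-1\}$, then $f(u_0,\dots,u_{n-1})\to f(v_0,\dots,v_{n-1})$ is an edge of $G$; 3. the neighborhood $N(a)=\{b\in A : a\to b\}$ absorbs $\{a\}$ with respect to $f$: for every $i\in\{0,\dots,n-1\}$ and all $x_j\in N(a)$ ($j\ne i$), we have $f(x_0,\dots,x_{i-1},a,x_{i+1},\dots,x_{n-1})\in N(a)$. Then $G$ contains a loop, that is, there is a vertex $v\in A$ with $v\to v$. -/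

import Mathlib

/-- An `n`-ary operation `t` on `A` is idempotent if `t (x, …, x) = x` for every `x`. -/
def IsIdempotentOp {A : Type*} {n : ℕ} (t : (Fin n → A) → A) : Prop :=
  ∀ x : A, t (fun _ => x) = x

/-- `X` absorbs `Y` with respect to `t`: the value of `t` lies in `X` whenever one argument, at an
arbitrary coordinate, is taken from `Y` and all the other arguments are taken from `X`. -/
def OpAbsorbs {A : Type*} {n : ℕ} (t : (Fin n → A) → A) (X Y : Set A) : Prop :=
  ∀ (i : Fin n) (x : Fin n → A), x i ∈ Y → (∀ j, j ≠ i → x j ∈ X) → t x ∈ X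

namespace Digraph

/-- An undirected graph is a digraph with a symmetric set of edges (loops are allowed). -/
def IsUndirected {A : Type*} (G : Digraph A) : Prop :=
  ∀ u v : A, G.Adj u v → G.Adj v u

/-- The edge relation of `G` is preserved by the operation `t`, applied coordinatewise to pairs. -/
def IsCompatible {A : Type*} (G : Digraph A) {n : ℕ} (t : (Fin n → A) → A) : Prop :=
  ∀ u v : Fin n → A, (∀ i, G.Adj (u i) (v i)) → G.Adj (t u) (t v)

/-- The set of (out-)neighbors of `a`. -/
def neighborhood {A : Type*} (G : Digraph A) (a : A) : Set A :=
  {b | G.Adj a b}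

/-- `w = [w 0, …, w l]` is a cycle walk of length `l`: consecutive vertices are joined by an edge
and `w 0 = w l`. -/
def IsCycleWalk {A : Type*} (G : Digraph A) {l : ℕ} (w : Fin (l + 1) → A) : Prop :=
  (∀ i : Fin l, G.Adj (w i.castSucc) (w i.succ)) ∧ w 0 = w (Fin.last l)

/-- `a` lies on some cycle walk of odd length (in particular, on some odd cycle). -/
def MemOddCycle {A : Type*} (G : Digraph A) (a : A) : Prop :=
  ∃ (l : ℕ) (w : Fin (l + 1) → A), Odd l ∧ G.IsCycleWalk w ∧ ∃ i, w i = a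

/-- `G` has a loop. -/
def HasLoop {A : Type*} (G : Digraph A) : Prop :=
  ∃ v : A, G.Adj v v

end Digraph

/-! Label each stream over the coordinates of `f` by a vertex determined by its first N letters. If
every label were adjacent to the label of the shifted stream, evaluating the complete `f`-tree of
depth N + 1 on both labellings would give an edge, and idempotence identifies its two ends: a loop.

Periodic streams obstruct this: a constant stream is fixed by the shift. So streams with a long
periodic prefix get the label `a`. One next letter continues the period, all others lead to
neighbours of `a`, and absorption supplies the missing edge (`hasLoop_of_labelling`).

Elsewhere, markers with bounded gaps longer than 2m cut the stream (`exists_isStop`,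
`not_isStop_shift`). A closed walk of length 2m + 1 through `a` fills every gap: it has two arms of
length m and an edge opposite to `a`, along which surplus length is spent (`armWalk_adj`). -/

/-- The stream `w` with its first `i` letters removed. -/
def streamShift {α : Type*} (i : ℕ) (w : ℕ → α) : ℕ → α := fun k => w (k + i)

/-- The stream `w` with the letter `x` put in front. -/
def streamCons {α : Type*} (x : α) (w : ℕ → α) : ℕ → α
  | 0 => x
  | k + 1 => w k

/-- The first `j` letters of `s`, followed by `t`. -/
def streamSplice {α : Type*} (j : ℕ) (s t : ℕ → α) : ℕ → α :=
  fun k => if k < j then s k else t (k - j)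

/-- `g w` depends only on the first `N` letters of `w`. -/
def DependsOnPrefix {α β : Type*} (N : ℕ) (g : (ℕ → α) → β) : Prop :=
  ∀ w w' : ℕ → α, (∀ i < N, w i = w' i) → g w = g w'

/-- The first `l` letters of `w` have a period between `1` and `P`. -/
def PrefixPeriodic {α : Type*} (P l : ℕ) (w : ℕ → α) : Prop :=
  ∃ p, 1 ≤ p ∧ p ≤ P ∧ ∀ i, i + p < l → w (i + p) = w i

/-! ### Streams and periodic prefixes -/

section Streams

variable {α : Type*}

@[simp] theorem streamShift_zero (w : ℕ → α) : streamShift 0 w = w := rfl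

theorem streamShift_shift (i j : ℕ) (w : ℕ → α) :
    streamShift i (streamShift j w) = streamShift (i + j) w := by
  funext k
  simp [streamShift, add_assoc]

@[simp] theorem streamShift_one_cons (x : α) (w : ℕ → α) :
    streamShift 1 (streamCons x w) = w := rfl

theorem streamCons_splice (x : α) (j : ℕ) (s t : ℕ → α) :
    streamCons x (streamSplice j s t) = streamSplice (j + 1) (streamCons x s) t := by
  funext k
  cases k with
  | zero => simp [streamCons, streamSplice]
  | succ k => simp [streamCons, streamSplice]

theorem DependsOnPrefix.mono {β : Type*} {N N' : ℕ} {g : (ℕ → α) → β}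
    (h : DependsOnPrefix N g) (hN : N ≤ N') : DependsOnPrefix N' g :=
  fun w w' hw => h w w' fun i hi => hw i (hi.trans_le hN)

theorem DependsOnPrefix.comp_cons {β : Type*} {N : ℕ} {g : (ℕ → α) → β}
    (h : DependsOnPrefix (N + 1) g) (x : α) :
    DependsOnPrefix N fun w => g (streamCons x w) := by
  intro w w' hw
  refine h _ _ fun i hi => ?_
  cases i with
  | zero => rfl
  | succ i => exact hw i (by omega)

theorem DependsOnPrefix.comp_shift {β : Type*} {N K : ℕ} {g : (ℕ → α) → β}
    (h : DependsOnPrefix N g) {i : ℕ} (hi : i ≤ K) :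
    DependsOnPrefix (N + K) fun w => g (streamShift i w) :=
  fun _ _ hw => h _ _ fun k hk => hw (k + i) (by omega)

theorem DependsOnPrefix.comp_shift_var {β : Type*} {N M K : ℕ} {g : (ℕ → α) → β}
    {D : (ℕ → α) → ℕ} (h : DependsOnPrefix N g) (hD : DependsOnPrefix M D) (hK : ∀ w, D w ≤ K) :
    DependsOnPrefix (N + K + M) fun w => g (streamShift (D w) w) := by
  intro w w' hw
  have h1 : D w = D w' := hD w w' fun i hi => hw i (by omega)
  show g _ = g _
  rw [← h1]
  exact h.comp_shift (hK w) w w' fun i hi => hw i (by omega)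

namespace PrefixPeriodic

variable {P l : ℕ} {w : ℕ → α}

theorem anti {l' : ℕ} (h : PrefixPeriodic P l w) (hl : l' ≤ l) : PrefixPeriodic P l' w := by
  obtain ⟨p, h1, h2, h3⟩ := h
  exact ⟨p, h1, h2, fun i hi => h3 i (by omega)⟩

theorem shift {i l' : ℕ} (h : PrefixPeriodic P l w) (hl : l' + i ≤ l) :
    PrefixPeriodic P l' (streamShift i w) := by
  obtain ⟨p, h1, h2, h3⟩ := h
  refine ⟨p, h1, h2, fun k hk => ?_⟩
  have := h3 (k + i) (by omega)
  simp only [streamShift]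
  rw [← this]
  congr 1
  omega

theorem dependsOnPrefix (P l : ℕ) :
    DependsOnPrefix l (fun w : ℕ → α => PrefixPeriodic P l w) := by
  have key : ∀ w w' : ℕ → α, (∀ i < l, w i = w' i) →
      PrefixPeriodic P l w → PrefixPeriodic P l w' := by
    rintro w w' hw ⟨p, h1, h2, h3⟩
    refine ⟨p, h1, h2, fun i hi => ?_⟩
    rw [← hw _ hi, ← hw i (by omega), h3 i hi]
  intro w w' hw
  exact propext ⟨key w w' hw, key w' w fun i hi => (hw i hi).symm⟩

/-- Two overlapping periodic blocks predict the same next letter. -/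
theorem extend {i l' : ℕ} (h : PrefixPeriodic P l w) (h' : PrefixPeriodic P l' (streamShift i w))
    (hl : l + 1 ≤ i + l') (hi : i + 2 * P ≤ l) : PrefixPeriodic P (l + 1) w := by
  obtain ⟨p, h1, h2, h3⟩ := h
  obtain ⟨q, g1, g2, g3⟩ := h'
  refine ⟨p, h1, h2, fun k hk => ?_⟩
  rcases Nat.lt_or_ge (k + p) l with hlt | hge
  · exact h3 k hlt
  -- Here w l = w (l - q) = w (l - q - p) = w (l - p); an overlap of 2P letters keeps l - q - p
  -- inside both blocks.
  · have hkl : k + p = l := by omega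
    have e1 := g3 (l - q - i) (by omega)
    have e2 := h3 (l - q - p) (by omega)
    have e3 := g3 (l - q - p - i) (by omega)
    simp only [streamShift] at e1 e3
    rw [show l - q - i + q + i = l by omega, show l - q - i + i = l - q by omega] at e1
    rw [show l - q - p + p = l - q by omega] at e2
    rw [show l - q - p - i + q + i = l - p by omega,
      show l - q - p - i + i = l - q - p by omega] at e3
    rw [hkl, e1, e2, ← e3]
    congr 1
    omega

/-- A periodic block that ends can be shortened from the left to any length. -/
theorem exists_shift_exact {c l' : ℕ} (h : PrefixPeriodic P l w) (h' : ¬ PrefixPeriodic P l' w)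
    (hc : c ≤ l) (hP : 2 * P ≤ c) :
    ∃ d ≤ l', PrefixPeriodic P c (streamShift d w) ∧
      ¬ PrefixPeriodic P (c + 1) (streamShift d w) := by
  classical
  have hex : ∃ k, ¬ PrefixPeriodic P k w := ⟨l', h'⟩
  obtain ⟨k, hk⟩ : ∃ k, Nat.find hex = k := ⟨_, rfl⟩
  have hk1 : ¬ PrefixPeriodic P k w := hk ▸ Nat.find_spec hex
  have hk2 : k ≤ l' := hk ▸ Nat.find_min' hex h'
  have hlk : l < k := by
    by_contra hcon
    exact hk1 (h.anti (by omega))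
  have hk3 : PrefixPeriodic P (k - 1) w := by
    by_contra hcon
    exact Nat.find_min hex (by omega : k - 1 < Nat.find hex) hcon
  -- Keep the last c letters of the maximal periodic prefix, of length k - 1; as c ≥ 2P, extending
  -- them would extend the whole prefix.
  refine ⟨k - 1 - c, by omega, hk3.shift (by omega), fun hcon => hk1 ?_⟩
  have := hk3.extend hcon (by omega) (by omega)
  rwa [show k - 1 + 1 = k by omega] at this

end PrefixPeriodic

end Streams

/-! ### Evaluating trees of `f` -/

section TreeEvaluation

variable {A : Type*} {n : ℕ}

/-- The value of the complete tree of depth `k` with inner nodes `f` whose leaves are labelled by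
`φ`; the leaf reached along a word is labelled by the value of `φ` at this word continued by `s`. -/
def treeEval (f : (Fin n → A) → A) (s : ℕ → Fin n) : ℕ → ((ℕ → Fin n) → A) → A
  | 0, φ => φ s
  | k + 1, φ => f fun i => treeEval f s k fun w => φ (streamCons i w)

variable {f : (Fin n → A) → A} {s : ℕ → Fin n}

theorem treeEval_const (hf : IsIdempotentOp f) (k : ℕ) (x : A) :
    treeEval f s k (fun _ => x) = x := by
  induction k with
  | zero => rfl
  | succ k ih => simp only [treeEval, ih]; exact hf x

/-- The bottom level sees constant arguments and collapses by idempotence. -/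
theorem treeEval_succ_of_dependsOnPrefix (hf : IsIdempotentOp f) {k : ℕ} {φ : (ℕ → Fin n) → A}
    (h : DependsOnPrefix k φ) : treeEval f s (k + 1) φ = treeEval f s k φ := by
  induction k generalizing φ with
  | zero =>
    have : ∀ i, φ (streamCons i s) = φ s := fun i => h _ _ fun j hj => by omega
    simp only [treeEval, this]
    exact hf _
  | succ k ih =>
    rw [treeEval]
    conv_rhs => rw [treeEval]
    congr 1
    funext i
    exact ih (h.comp_cons i)

/-- Here it is the root that collapses: the labels ignore the first letter. -/
theorem treeEval_succ_shift (hf : IsIdempotentOp f) (k : ℕ) (φ : (ℕ → Fin n) → A) :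
    treeEval f s (k + 1) (fun w => φ (streamShift 1 w)) = treeEval f s k φ := by
  simp only [treeEval, streamShift_one_cons]
  exact hf _

variable {G : Digraph A}

theorem treeEval_adj (hf : G.IsCompatible f) {k : ℕ} {φ ψ : (ℕ → Fin n) → A}
    (h : ∀ w, G.Adj (φ w) (ψ w)) : G.Adj (treeEval f s k φ) (treeEval f s k ψ) := by
  induction k generalizing φ ψ with
  | zero => exact h s
  | succ k ih => exact hf _ _ fun i => ih fun w => h _

theorem treeEval_adj_of_splice (hf : G.IsCompatible f) {j k : ℕ} {φ ψ : (ℕ → Fin n) → A}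
    (h : ∀ u, G.Adj (treeEval f s k fun w => φ (streamSplice j u w))
      (treeEval f s k fun w => ψ (streamSplice j u w))) :
    G.Adj (treeEval f s (k + j) φ) (treeEval f s (k + j) ψ) := by
  induction j generalizing φ ψ with
  | zero =>
    have hz : ∀ w, streamSplice 0 s w = w := fun w => by funext k; simp [streamSplice]
    simpa only [hz, Nat.add_zero] using h s
  | succ j ih =>
    refine hf _ _ fun i => ih fun u => ?_
    simpa only [streamCons_splice] using h (streamCons i u)

/-- A labelling of streams that is a homomorphism from the shift graph to `G`, except for a set of
streams labelled by `a` at which absorption applies, produces a loop. -/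
theorem hasLoop_of_labelling {a : A} (hidem : IsIdempotentOp f) (hcomp : G.IsCompatible f)
    (habs : OpAbsorbs f (G.neighborhood a) {a}) (s : ℕ → Fin n) {N j : ℕ}
    {φ : (ℕ → Fin n) → A} (hN : DependsOnPrefix N φ) (hj : j ≤ N)
    (h : ∀ u, (∀ w, G.Adj (φ (streamSplice j u w)) (φ (streamShift 1 (streamSplice j u w)))) ∨
      ((∀ w, φ (streamSplice j u w) = a) ∧ ∃ x, ∀ y w,
        (y = x → φ (streamShift 1 (streamSplice j u (streamCons y w))) = a) ∧
        (y ≠ x → G.Adj a (φ (streamShift 1 (streamSplice j u (streamCons y w))))))) :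
    G.HasLoop := by
  refine ⟨treeEval f s N φ, ?_⟩
  -- The top j levels spell u, and at least one level remains below to read the next letter.
  have key : G.Adj (treeEval f s (N - j + 1 + j) φ)
      (treeEval f s (N - j + 1 + j) fun w => φ (streamShift 1 w)) := by
    refine treeEval_adj_of_splice hcomp fun u => ?_
    rcases h u with h | ⟨ha, x, hx⟩
    · exact treeEval_adj hcomp h
    · simp only [ha, treeEval_const hidem]
      refine habs x _ ?_ fun y hy => ?_
      · simp only [fun w => (hx x w).1 rfl, treeEval_const hidem, Set.mem_singleton_iff]
      · have := treeEval_adj (s := s) (k := N - j) hcomp fun w => (hx y w).2 hy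
        rwa [treeEval_const hidem] at this
  rwa [show N - j + 1 + j = N + 1 by omega, treeEval_succ_of_dependsOnPrefix hidem hN,
    treeEval_succ_shift hidem] at key

end TreeEvaluation

/-! ### Markers in streams -/

namespace StreamMarker

variable {n : ℕ}

open Classical in
/-- An injective numbering of the prefixes of length `2 * P`; streams whose prefix of length
`2 * P + 1` is periodic get the maximal cost. -/
noncomputable def cost (P : ℕ) (w : ℕ → Fin n) : ℕ :=
  if PrefixPeriodic P (2 * P + 1) w then Fintype.card (Fin (2 * P) → Fin n)
  else Fintype.equivFin (Fin (2 * P) → Fin n) fun i => w i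

/-- The cost of `w` shifted by `P` is a strict minimum in a window of radius `P`. -/
def IsLocalMin (P : ℕ) (w : ℕ → Fin n) : Prop :=
  ∀ i ≤ 2 * P, i ≠ P → cost P (streamShift P w) < cost P (streamShift i w)

/-- The maximal periodic prefix has length exactly `4 * P + 1`. -/
def IsRunEnd (P : ℕ) (w : ℕ → Fin n) : Prop :=
  PrefixPeriodic P (4 * P + 1) w ∧ ¬ PrefixPeriodic P (4 * P + 1 + 1) w

/-- The stream starts with a long periodic block. -/
def IsRun (m : ℕ) (w : ℕ → Fin n) : Prop :=
  PrefixPeriodic (2 * m) (4 * (2 * m) + 1 + m) w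

/-- The streams at which the labelling changes its phase. -/
def IsStop (m : ℕ) (w : ℕ → Fin n) : Prop :=
  IsLocalMin (2 * m) w ∨ IsRunEnd (2 * m) w ∨ IsRun m w

theorem cost_le (P : ℕ) (w : ℕ → Fin n) : cost P w ≤ Fintype.card (Fin (2 * P) → Fin n) := by
  unfold cost
  split_ifs
  · exact le_rfl
  · exact (Fin.is_lt _).le

theorem cost_lt_iff {P : ℕ} {w : ℕ → Fin n} :
    cost P w < Fintype.card (Fin (2 * P) → Fin n) ↔ ¬ PrefixPeriodic P (2 * P + 1) w := by
  unfold cost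
  split_ifs with h
  · simp [h]
  · exact iff_of_true (Fin.is_lt _) h

/-- Equal nonmaximal costs identify two windows of length 2P at distance i, which makes i a period
of the first 2P + 1 letters. -/
theorem cost_shift_ne {P i : ℕ} {w : ℕ → Fin n}
    (h : cost P w < Fintype.card (Fin (2 * P) → Fin n)) (h1 : 1 ≤ i) (hi : i ≤ P) :
    cost P (streamShift i w) ≠ cost P w := by
  intro he
  have hw := cost_lt_iff.1 h
  have hw' := cost_lt_iff.1 (he ▸ h)
  unfold cost at he
  rw [if_neg hw, if_neg hw'] at he
  have he' := congrFun ((Fintype.equivFin (Fin (2 * P) → Fin n)).injective (Fin.ext he))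
  refine hw ⟨i, h1, hi, fun k hk => ?_⟩
  exact he' ⟨k, by omega⟩

theorem dependsOnPrefix_cost (P : ℕ) :
    DependsOnPrefix (2 * P + 1) (cost P : (ℕ → Fin n) → ℕ) := by
  intro w w' hw
  have h1 := PrefixPeriodic.dependsOnPrefix P (2 * P + 1) w w' hw
  have h2 : (fun i : Fin (2 * P) => w i) = fun i : Fin (2 * P) => w' i :=
    funext fun i => hw i (by omega)
  unfold cost
  rw [h2]
  classical exact if_congr (iff_of_eq h1) rfl rfl

theorem dependsOnPrefix_isStop (m : ℕ) :
    DependsOnPrefix (20 * m + 2) (IsStop m : (ℕ → Fin n) → Prop) := by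
  intro w w' hw
  have h0 : ∀ i ≤ 2 * (2 * m),
      cost (2 * m) (streamShift i w) = cost (2 * m) (streamShift i w') := fun i hi =>
    (dependsOnPrefix_cost (2 * m)).comp_shift hi w w' fun k hk => hw k (by omega)
  have h1 : IsLocalMin (2 * m) w = IsLocalMin (2 * m) w' := by
    unfold IsLocalMin
    refine propext (forall_congr' fun i => forall_congr' fun hi => ?_)
    rw [h0 i hi, h0 _ (by omega)]
  have h2 : ∀ l ≤ 20 * m + 2, PrefixPeriodic (2 * m) l w = PrefixPeriodic (2 * m) l w' :=
    fun l hl => PrefixPeriodic.dependsOnPrefix (2 * m) l w w' fun k hk => hw k (by omega)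
  unfold IsStop IsRunEnd IsRun
  rw [h1, h2 _ (by omega), h2 _ (by omega), h2 _ (by omega)]

/-- Descent on the cost: where the strict minimum fails, a position within P has cost at most q, and
not q by `cost_shift_ne`. At most q moves of length at most P occur; the lower bound on x leaves
room to the left. -/
theorem exists_isLocalMin {P : ℕ} (w : ℕ → Fin n) (q : ℕ) :
    ∀ x, cost P (streamShift x w) = q → q < Fintype.card (Fin (2 * P) → Fin n) →
      (q + 1) * P ≤ x → ∃ y ≤ x + q * P, IsLocalMin P (streamShift y w) := by
  induction q using Nat.strong_induction_on with
  | _ q ih =>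
    intro x hx hq hqx
    have hPx : P ≤ x := le_trans (by nlinarith) hqx
    by_cases hmin : IsLocalMin P (streamShift (x - P) w)
    · exact ⟨x - P, by omega, hmin⟩
    · unfold IsLocalMin at hmin
      push Not at hmin
      obtain ⟨i, hi, hiP, hle⟩ := hmin
      rw [streamShift_shift, streamShift_shift, show P + (x - P) = x by omega, hx] at hle
      have hne : cost P (streamShift (i + (x - P)) w) ≠ q := by
        intro he
        rcases Nat.lt_or_gt_of_ne hiP with hlt | hgt
        · refine cost_shift_ne (w := streamShift (i + (x - P)) w) (i := P - i)
            (he ▸ hq) (by omega) (by omega) ?_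
          rw [streamShift_shift, show P - i + (i + (x - P)) = x by omega, hx, he]
        · refine cost_shift_ne (w := streamShift x w) (i := i - P)
            (hx ▸ hq) (by omega) (by omega) ?_
          rw [streamShift_shift, show i - P + x = i + (x - P) by omega, hx, he]
      obtain ⟨q', hq'⟩ : ∃ q', cost P (streamShift (i + (x - P)) w) = q' := ⟨_, rfl⟩
      rw [hq'] at hle hne
      have hlt : q' < q := by omega
      have hmul : (q' + 1) * P ≤ q * P := Nat.mul_le_mul_right P hlt
      have hexp : (q + 1) * P = q * P + P := by ring
      have hexp' : (q' + 1) * P = q' * P + P := by ring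
      obtain ⟨y, hy, hy'⟩ := ih q' hlt _ hq' (by omega) (by omega)
      exact ⟨y, by omega, hy'⟩

theorem exists_isStop (n m : ℕ) :
    ∃ K, ∀ w : ℕ → Fin n, ∃ d ≤ K, IsStop m (streamShift d w) := by
  obtain ⟨Q, hQ⟩ : ∃ Q, Fintype.card (Fin (2 * (2 * m)) → Fin n) = Q := ⟨_, rfl⟩
  -- X is the room to the left that the descent needs from any starting cost.
  obtain ⟨X, hX⟩ : ∃ X, (Q + 1) * (2 * m) = X := ⟨_, rfl⟩
  refine ⟨2 * X + (4 * (2 * m) + 1 + m), fun w => ?_⟩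
  by_cases h2 : IsRun m (streamShift X w)
  · exact ⟨X, by omega, Or.inr (Or.inr h2)⟩
  by_cases h0 : PrefixPeriodic (2 * m) (4 * (2 * m) + 1) (streamShift X w)
  · obtain ⟨d, hd, hd1, hd2⟩ := h0.exists_shift_exact h2 le_rfl (by omega)
    rw [streamShift_shift] at hd1 hd2
    exact ⟨d + X, by omega, Or.inr (Or.inl ⟨hd1, hd2⟩)⟩
  have hval : ∃ d ≤ 4 * (2 * m) + 1,
      ¬ PrefixPeriodic (2 * m) (2 * (2 * m) + 1) (streamShift (d + X) w) := by
    by_cases h1 : PrefixPeriodic (2 * m) (2 * (2 * m) + 1) (streamShift X w)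
    · obtain ⟨d, hd, -, hd2⟩ := h1.exists_shift_exact h0 (Nat.le_succ _) le_rfl
      rw [streamShift_shift] at hd2
      exact ⟨d, hd, hd2⟩
    · exact ⟨0, by omega, by rwa [Nat.zero_add]⟩
  obtain ⟨d, hd, hd'⟩ := hval
  have hlt := cost_lt_iff.2 hd'
  have hb : (cost (2 * m) (streamShift (d + X) w) + 1) * (2 * m) ≤ X :=
    (Nat.mul_le_mul_right _ (by omega)).trans hX.le
  obtain ⟨y, hy, hy'⟩ := exists_isLocalMin w _ (d + X) rfl hlt (by omega)
  rw [Nat.add_mul] at hb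
  exact ⟨y, by omega, Or.inl hy'⟩

theorem IsLocalMin.not_prefixPeriodic {P : ℕ} (hP : 1 ≤ P) {w : ℕ → Fin n}
    (h : IsLocalMin P w) : ¬ PrefixPeriodic P (2 * P + 1) (streamShift P w) :=
  cost_lt_iff.1 ((h 0 (by omega) (by omega)).trans_le (cost_le _ _))

theorem not_isLocalMin_of_prefixPeriodic {P l i : ℕ} (hP : 1 ≤ P) {w : ℕ → Fin n}
    (h : PrefixPeriodic P l w) (hl : 3 * P + 1 + i ≤ l) : ¬ IsLocalMin P (streamShift i w) := by
  intro hmin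
  have := hmin.not_prefixPeriodic hP
  rw [streamShift_shift] at this
  exact this (h.shift (by omega))

/-- Stops outside of long periodic blocks are isolated. -/
theorem not_isStop_shift {m i : ℕ} (hm : 1 ≤ m) {w : ℕ → Fin n} (hw : IsStop m w)
    (hr : ¬ IsRun m w) (h1 : 1 ≤ i) (hi : i ≤ 2 * m) : ¬ IsStop m (streamShift i w) := by
  have hper : IsRunEnd (2 * m) (streamShift i w) ∨ IsRun m (streamShift i w) →
      PrefixPeriodic (2 * m) (4 * (2 * m) + 1) (streamShift i w) := by
    rintro (h | h)
    · exact h.1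
    · exact h.anti (by omega)
  rcases hw with hw | hw | hw
  · rintro (h | h)
    · have e1 := hw (i + 2 * m) (by omega) (by omega)
      have e2 := h (2 * m - i) (by omega) (by omega)
      rw [streamShift_shift, streamShift_shift, show 2 * m - i + i = 2 * m by omega,
        Nat.add_comm] at e2
      exact lt_asymm e1 e2
    · refine hw.not_prefixPeriodic (by omega) ?_
      have := (hper h).shift (i := 2 * m - i) (l' := 2 * (2 * m) + 1) (by omega)
      rwa [streamShift_shift, show 2 * m - i + i = 2 * m by omega] at this
  · rintro (h | h)
    -- With P = 2m, the length 4P + 1 is what is needed here: the centre i + P ≤ 2P still sees 2P +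
    -- 1 periodic letters.
    · exact not_isLocalMin_of_prefixPeriodic (by omega) hw.1 (by omega) h
    · exact hw.2 (hw.1.extend (hper h) (by omega) (by omega))
  · exact absurd hw hr

/-- Where a long periodic block ends, the next stop is at distance `m`. -/
theorem isStop_shift_iff_of_isRun {m i : ℕ} (hm : 1 ≤ m) {w : ℕ → Fin n} (hw : IsRun m w)
    (hw' : ¬ PrefixPeriodic (2 * m) (4 * (2 * m) + 1 + m + 1) w) (h1 : 1 ≤ i) (hi : i ≤ m) :
    ¬ IsRun m (streamShift i w) ∧ (IsStop m (streamShift i w) ↔ i = m) := by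
  have hr : ¬ IsRun m (streamShift i w) := fun h => hw' (hw.extend h (by omega) (by omega))
  refine ⟨hr, ?_, ?_⟩
  · rintro (h | h | h)
    · exact absurd h (not_isLocalMin_of_prefixPeriodic (by omega) hw (by omega))
    · by_contra hne
      exact h.2 (hw.shift (by omega))
    · exact absurd h hr
  · rintro rfl
    refine Or.inr (Or.inl ⟨hw.shift le_rfl, fun h => hw' (hw.extend h (by omega) (by omega))⟩)

/-! ### Time until the next marker -/

open Classical in
/-- The distance to the next stop. -/
noncomputable def dist (m : ℕ) (w : ℕ → Fin n) : ℕ :=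
  Nat.find (show ∃ d, IsStop m (streamShift d w) from
    ((exists_isStop n m).choose_spec w).imp fun _ h => h.2)

open Classical in
/-- The time at which a stream is reached, counted backwards from the next stop; long periodic
blocks stay at time `m`. -/
noncomputable def time (m : ℕ) (w : ℕ → Fin n) : ℕ :=
  dist m w + if IsRun m (streamShift (dist m w) w) then m else 0

open Classical in
/-- The side from which the walk starts at the next stop. -/
noncomputable def side (m : ℕ) (w : ℕ → Fin n) : Bool :=
  !decide (Even (time m (streamShift (dist m w + 1) w)))

theorem isStop_dist (m : ℕ) (w : ℕ → Fin n) : IsStop m (streamShift (dist m w) w) := by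
  classical exact Nat.find_spec (p := fun d => IsStop m (streamShift d w)) _

theorem dist_eq {m d : ℕ} {w : ℕ → Fin n} (h : IsStop m (streamShift d w))
    (h' : ∀ i < d, ¬ IsStop m (streamShift i w)) : dist m w = d := by
  classical exact (Nat.find_eq_iff _).2 ⟨h, h'⟩

theorem not_isStop_of_lt_dist {m i : ℕ} {w : ℕ → Fin n} (h : i < dist m w) :
    ¬ IsStop m (streamShift i w) := by
  classical exact Nat.find_min (p := fun d => IsStop m (streamShift d w)) _ h

theorem dist_eq_succ {m : ℕ} {w : ℕ → Fin n} (h : ¬ IsStop m w) :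
    dist m w = dist m (streamShift 1 w) + 1 := by
  refine dist_eq ?_ fun i hi => ?_
  · have := isStop_dist m (streamShift 1 w)
    rwa [streamShift_shift] at this
  · cases i with
    | zero => exact h
    | succ i =>
      have := not_isStop_of_lt_dist (m := m) (w := streamShift 1 w) (i := i) (by omega)
      rwa [streamShift_shift] at this

theorem dist_eq_zero {m : ℕ} {w : ℕ → Fin n} (h : IsStop m w) : dist m w = 0 :=
  dist_eq h fun i hi => absurd hi (Nat.not_lt_zero i)

theorem exists_dependsOnPrefix_time_side (n m : ℕ) :
    ∃ N, DependsOnPrefix N fun w : ℕ → Fin n => (time m w, side m w) := by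
  classical
  obtain ⟨K, hK⟩ := exists_isStop n m
  have hdK : ∀ w : ℕ → Fin n, dist m w ≤ K := by
    intro w
    obtain ⟨d, hd, hd'⟩ := hK w
    by_contra hcon
    exact not_isStop_of_lt_dist (by omega) hd'
  have hdist : DependsOnPrefix (20 * m + 2 + K) (dist m : (ℕ → Fin n) → ℕ) := by
    intro w w' hw
    have hst : ∀ i ≤ K, IsStop m (streamShift i w) = IsStop m (streamShift i w') := fun i hi =>
      (dependsOnPrefix_isStop m).comp_shift hi w w' hw
    refine dist_eq ?_ fun i hi => ?_
    · rw [hst _ (hdK w')]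
      exact isStop_dist m w'
    · rw [hst _ (hi.le.trans (hdK w'))]
      exact not_isStop_of_lt_dist hi
  have hrun := (PrefixPeriodic.dependsOnPrefix (α := Fin n) (2 * m)
    (4 * (2 * m) + 1 + m)).comp_shift_var hdist hdK
  obtain ⟨N, hN⟩ : ∃ N, DependsOnPrefix N (time m : (ℕ → Fin n) → ℕ) := by
    refine ⟨(4 * (2 * m) + 1 + m) + K + (20 * m + 2 + K), fun w w' hw => ?_⟩
    have h1 := hdist w w' fun i hi => hw i (by omega)
    have h2 : IsRun m (streamShift (dist m w) w) = IsRun m (streamShift (dist m w') w') :=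
      hrun w w' hw
    exact congrArg₂ (· + ·) h1 (if_congr (Eq.to_iff h2) rfl rfl)
  have hside := hN.comp_shift_var (D := fun w => dist m w + 1) (K := K + 1)
    (fun w w' hw => congrArg (· + 1) (hdist w w' hw)) fun w => Nat.succ_le_succ (hdK w)
  refine ⟨N + (K + 1) + (20 * m + 2 + K), fun w w' hw => Prod.ext ?_ ?_⟩
  · exact hN w w' fun i hi => hw i (by omega)
  · have := hside w w' hw
    simp only at this
    simp only [side, this]

theorem time_side_of_not_isStop {m : ℕ} {w : ℕ → Fin n} (h : ¬ IsStop m w) :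
    time m w = time m (streamShift 1 w) + 1 ∧ side m w = side m (streamShift 1 w) := by
  have hd := dist_eq_succ h
  constructor
  · have hs : streamShift (dist m w) w =
        streamShift (dist m (streamShift 1 w)) (streamShift 1 w) := by
      rw [streamShift_shift, hd]
    unfold time
    rw [hs, hd]
    omega
  · simp only [side, hd, streamShift_shift]

theorem time_of_isRun {m : ℕ} {w : ℕ → Fin n} (h : IsRun m w) : time m w = m := by
  have hd : dist m w = 0 := dist_eq_zero (Or.inr (Or.inr h))
  simp [time, hd, h]

/-- After an isolated stop the time is at least 2m, so `armWalk` is already alternating, and `side`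
selects the opposite end of its edge. -/
theorem time_side_of_isStop {m : ℕ} (hm : 1 ≤ m) {w : ℕ → Fin n} (h : IsStop m w)
    (hr : ¬ IsRun m w) :
    time m w = 0 ∧ side m w = !decide (Even (time m (streamShift 1 w))) ∧
      2 * m ≤ time m (streamShift 1 w) := by
  have hd : dist m w = 0 := dist_eq_zero h
  refine ⟨by simp [time, hd, hr], by simp [side, hd], ?_⟩
  have : 2 * m ≤ dist m (streamShift 1 w) := by
    by_contra hcon
    have hs := isStop_dist m (streamShift 1 w)
    rw [streamShift_shift] at hs
    exact not_isStop_shift hm h hr (by omega) (by omega) hs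
  unfold time
  omega

theorem time_shift_of_run_ends {m : ℕ} (hm : 1 ≤ m) {w : ℕ → Fin n} (hw : IsRun m w)
    (hw' : ¬ PrefixPeriodic (2 * m) (4 * (2 * m) + 1 + m + 1) w) :
    time m (streamShift 1 w) + 1 = m := by
  have hd : dist m (streamShift 1 w) = m - 1 := by
    refine dist_eq ?_ fun i hi => ?_
    · rw [streamShift_shift, (isStop_shift_iff_of_isRun hm hw hw' (by omega) (by omega)).2]
      omega
    · rw [streamShift_shift, (isStop_shift_iff_of_isRun hm hw hw' (by omega) (by omega)).2]
      omega
  unfold time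
  rw [hd, streamShift_shift, show m - 1 + 1 = m by omega,
    if_neg (isStop_shift_iff_of_isRun hm hw hw' hm le_rfl).1]
  omega

end StreamMarker

/-! ### Labelling by walks on the odd cycle -/

section OddCycle

variable {A : Type*} {G : Digraph A}

/-- The walk along the two arms `c false`, `c true` of an odd cycle: from the end of the arm `e` to
the common start of the arms, then to the end of the arm `true`, then alternating between the two
ends. -/
def armWalk (c : Bool → ℕ → A) (m : ℕ) (e : Bool) (t : ℕ) : A :=
  if t ≤ m then c e (m - t) else if t ≤ 2 * m then c true (t - m) else c (decide (Even t)) m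

theorem armWalk_of_two_mul_le (c : Bool → ℕ → A) {m : ℕ} (hm : 1 ≤ m) (e : Bool) {t : ℕ}
    (ht : 2 * m ≤ t) : armWalk c m e t = c (decide (Even t)) m := by
  unfold armWalk
  rw [if_neg (by omega)]
  split_ifs with h
  · have : t = 2 * m := by omega
    subst this
    simp [show 2 * m - m = m by omega]
  · rfl

/-- The arms meet at time m, so the choice of e is forgotten there; time 2m is even, so the
alternation takes over at the end of the arm `true`. -/
theorem armWalk_adj (hG : G.IsUndirected) {c : Bool → ℕ → A} {m : ℕ} (hm : 1 ≤ m)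
    (h0 : c false 0 = c true 0) (hc : ∀ e, ∀ i < m, G.Adj (c e i) (c e (i + 1)))
    (hend : ∀ e, G.Adj (c e m) (c (!e) m)) (e : Bool) (t : ℕ) :
    G.Adj (armWalk c m e (t + 1)) (armWalk c m e t) := by
  rcases Nat.lt_or_ge t m with h | h
  · have := hc e (m - (t + 1)) (by omega)
    rw [show m - (t + 1) + 1 = m - t by omega] at this
    unfold armWalk
    rwa [if_pos (by omega), if_pos (by omega)]
  rcases Nat.lt_or_ge t (2 * m) with h' | h'
  · have hw : armWalk c m e t = c true (t - m) := by
      unfold armWalk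
      by_cases h1 : t ≤ m
      · have : t = m := by omega
        subst this
        cases e <;> simp [h0]
      · rw [if_neg h1, if_pos h'.le]
    rw [hw]
    have := hG _ _ (hc true (t - m) (by omega))
    rw [show t - m + 1 = t + 1 - m by omega] at this
    unfold armWalk
    rwa [if_neg (by omega), if_pos (by omega)]
  · rw [armWalk_of_two_mul_le c hm e h', armWalk_of_two_mul_le c hm e (by omega)]
    have := hG _ _ (hend (decide (Even t)))
    rwa [show (!decide (Even t)) = decide (Even (t + 1)) by
      simp only [Nat.even_add_one, decide_not]] at this

open StreamMarker in
theorem hasLoop_of_arms {n : ℕ} {f : (Fin n → A) → A} {a : A} (hG : G.IsUndirected)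
    (hidem : IsIdempotentOp f) (hcomp : G.IsCompatible f)
    (habs : OpAbsorbs f (G.neighborhood a) {a}) (s : ℕ → Fin n) {c : Bool → ℕ → A} {m : ℕ}
    (hm : 1 ≤ m) (h0 : ∀ e, c e 0 = a) (hc : ∀ e, ∀ i < m, G.Adj (c e i) (c e (i + 1)))
    (hend : ∀ e, G.Adj (c e m) (c (!e) m)) : G.HasLoop := by
  obtain ⟨N, hN⟩ := exists_dependsOnPrefix_time_side n m
  obtain ⟨l, hl⟩ : ∃ l, 4 * (2 * m) + 1 + m = l := ⟨_, rfl⟩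
  let φ : (ℕ → Fin n) → A := fun w => armWalk c m (side m w) (time m w)
  have hφN : DependsOnPrefix N φ := fun w w' hw =>
    congrArg (fun x : ℕ × Bool => armWalk c m x.2 x.1) (hN w w' hw)
  have hrun : ∀ w, IsRun m w → φ w = a := fun w hw => by
    simp [φ, armWalk, time_of_isRun hw, h0]
  have hadj : ∀ w, ¬ IsRun m w → G.Adj (φ w) (φ (streamShift 1 w)) := by
    intro w hw
    by_cases hs : IsStop m w
    · obtain ⟨h1, h2, h3⟩ := time_side_of_isStop hm hs hw
      simp only [φ]
      rw [armWalk_of_two_mul_le c hm _ h3, h1, h2]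
      simpa [armWalk] using hG _ _ (hend (decide (Even (time m (streamShift 1 w)))))
    · obtain ⟨h1, h2⟩ := time_side_of_not_isStop hs
      simp only [φ]
      rw [h1, h2]
      exact armWalk_adj hG hm ((h0 _).trans (h0 _).symm) hc hend _ _
  have hleave : ∀ w, IsRun m w → ¬ PrefixPeriodic (2 * m) (l + 1) w →
      G.Adj a (φ (streamShift 1 w)) := by
    intro w hw hw'
    have ht := time_shift_of_run_ends hm hw (hl ▸ hw')
    have := hc (side m (streamShift 1 w)) 0 (by omega)
    rw [h0] at this
    simp only [φ, armWalk]
    rwa [if_pos (by omega),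
      show m - time m (streamShift 1 w) = 0 + 1 by omega]
  have hsplice : ∀ u w : ℕ → Fin n, IsRun m (streamSplice l u w) ↔ IsRun m u := fun u w => by
    refine iff_of_eq (PrefixPeriodic.dependsOnPrefix (2 * m) (4 * (2 * m) + 1 + m)
      (streamSplice l u w) u fun i hi => ?_)
    simp [streamSplice, show i < l by omega]
  refine hasLoop_of_labelling hidem hcomp habs s (hφN.mono (Nat.le_add_right N l))
    (Nat.le_add_left l N) fun u => ?_
  by_cases hu : IsRun m u
  · refine Or.inr ⟨fun w => hrun _ ((hsplice u w).2 hu), ?_⟩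
    obtain ⟨p, hp1, hp2, hp⟩ := id hu
    rw [hl] at hp
    -- The letter u (l - p) is the one continuing the period p.
    refine ⟨u (l - p), fun y w => ⟨fun hy => hrun _ ?_, fun hy => hleave _ ((hsplice u _).2 hu) ?_⟩⟩
    · refine PrefixPeriodic.shift (l := l + 1) ⟨p, hp1, hp2, fun i hi => ?_⟩ (by omega)
      rcases Nat.lt_or_ge (i + p) l with h | h
      · simp [streamSplice, h, show i < l by omega, hp i h]
      · have : i + p = l := by omega
        simp [streamSplice, this, show i < l by omega, streamCons, hy, show l - p = i by omega]
    -- Any other period q would predict the same letter, by comparison at l - q - p.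
    · rintro ⟨q, hq1, hq2, hq⟩
      refine hy ?_
      have e1 := hq (l - q) (by omega)
      have e2 := hp (l - q - p) (by omega)
      have e3 := hq (l - q - p) (by omega)
      rw [show l - q + q = l by omega] at e1
      rw [show l - q - p + p = l - q by omega] at e2
      rw [show l - q - p + q = l - p by omega] at e3
      simp only [streamSplice, lt_irrefl, if_false, Nat.sub_self, streamCons,
        show l - q < l by omega, show l - p < l by omega, show l - q - p < l by omega,
        if_true] at e1 e3
      rw [e1, e2, e3]
  · exact Or.inl fun w => hadj _ fun h => hu ((hsplice u w).1 h)

end OddCycle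

/-! ### From a closed odd walk to two arms -/

namespace Digraph

variable {A : Type*} {G : Digraph A} {a : A}

/-- A closed walk of odd length through `a`, as a periodic sequence starting at `a`. -/
theorem MemOddCycle.exists_sequence (h : G.MemOddCycle a) :
    ∃ (m : ℕ) (v : ℕ → A), v 0 = a ∧ v (2 * m + 1) = a ∧ ∀ i, G.Adj (v i) (v (i + 1)) := by
  obtain ⟨l, w, ⟨m, rfl⟩, ⟨hw, hw0⟩, i, rfl⟩ := h
  let u : ℕ → A := fun k => w ⟨k % (2 * m + 1), by
    have := Nat.mod_lt k (show 2 * m + 1 > 0 by omega); omega⟩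
  have hu : ∀ k, G.Adj (u k) (u (k + 1)) := by
    intro k
    have hlt := Nat.mod_lt k (show 2 * m + 1 > 0 by omega)
    have hk := hw ⟨k % (2 * m + 1), hlt⟩
    have he : u (k + 1) = w (Fin.succ ⟨k % (2 * m + 1), hlt⟩) := by
      rcases Nat.lt_or_ge (k % (2 * m + 1) + 1) (2 * m + 1) with h | h
      · have : (k + 1) % (2 * m + 1) = k % (2 * m + 1) + 1 := by
          rw [Nat.add_mod, Nat.mod_eq_of_lt (a := 1) (by omega), Nat.mod_eq_of_lt h]
        exact congrArg w (Fin.ext this)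
      · have h1 : (k + 1) % (2 * m + 1) = 0 := by
          have : k % (2 * m + 1) = 2 * m := by omega
          rw [← Nat.mod_add_mod, this, Nat.mod_self]
        have h2 : u (k + 1) = w 0 := congrArg w (Fin.ext h1)
        rw [h2, hw0]
        refine congrArg w (Fin.ext ?_)
        simp only [Fin.val_last, Fin.val_succ]
        omega
    rw [he]
    exact hk
  have hui : u i = w i := by
    rcases Nat.lt_or_ge (i : ℕ) (2 * m + 1) with h | h
    · exact congrArg w (Fin.ext (Nat.mod_eq_of_lt h))
    · have hi : (i : ℕ) = 2 * m + 1 := by omega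
      have h1 : u i = w 0 := congrArg w (Fin.ext (by simp [hi]))
      rw [h1, hw0]
      exact congrArg w (Fin.ext (by simp [hi]))
  refine ⟨m, fun k => u (i + k), hui, ?_, fun k => hu _⟩
  rw [← hui]
  exact congrArg w (Fin.ext (by simp))

end Digraph

theorem mainTheorem2 {A : Type*} {n : ℕ} (G : Digraph A) (f : (Fin n → A) → A) (a : A)
    (hG : G.IsUndirected) (hcycle : G.MemOddCycle a) (hidem : IsIdempotentOp f)
    (hcomp : G.IsCompatible f) (habs : OpAbsorbs f (G.neighborhood a) {a}) :
    G.HasLoop := by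
  obtain ⟨m, v, hv0, hvm, hv⟩ := hcycle.exists_sequence
  rcases Nat.eq_zero_or_pos n with rfl | hn
  -- An idempotent nullary operation forces `A` to have at most one point.
  · have hall : ∀ x y : A, x = y := fun x y => by
      rw [← hidem x, ← hidem y]
      exact congrArg f (funext fun i => i.elim0)
    refine ⟨v 0, ?_⟩
    have := hv 0
    rwa [hall (v (0 + 1)) (v 0)] at this
  rcases Nat.eq_zero_or_pos m with rfl | hm
  · refine ⟨a, ?_⟩
    have := hv 0
    rwa [hv0, show 0 + 1 = 2 * 0 + 1 from rfl, hvm] at this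
  -- The arms follow the closed walk from `a` in both directions; their ends v m and v (m + 1) are
  -- joined by the middle edge.
  refine hasLoop_of_arms hG hidem hcomp habs (fun _ => ⟨0, hn⟩)
    (c := fun e i => if e then v i else v (2 * m + 1 - i)) hm ?_ ?_ ?_
  · intro e
    cases e <;> simp [hv0, hvm]
  · intro e i hi
    cases e
    · have := hG _ _ (hv (2 * m + 1 - (i + 1)))
      rw [show 2 * m + 1 - (i + 1) + 1 = 2 * m + 1 - i by omega] at this
      simpa using this
    · simpa using hv i
  · intro e
    have := hv m
    have h2 : 2 * m + 1 - m = m + 1 := by omega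
    cases e
    · simpa [h2] using hG _ _ this
    · simpa [h2] using this
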